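/- Call a set $[i,i+1]\times[j,j+1]\subset\mathbb{R}^2$ with $i,j\in\mathbb{Z}$ an elementary square. Let $R$ be a 2-dimensional cubiculated region of the plane, i.e. a finite union of elementary squares. A domino in $R$ is a pair of elementary squares of $R$ that have a common edge, and a domino tiling of $R$ is a set of dominoes in $R$ such that every elementary square of $R$ belongs to exactly one of them. A local flip of a tiling replaces two parallel dominoes that together fill a $2\times 2$ block of squares by the two perpendicular dominoes that fill the same block. Suppose that $R$ is simply connected, in the sense that every simple closed curve in (the closed set) $R$ can be shrunk continuously to a point within $R$. Then for any two domino tilings $T_1, T_2$ of $R$ there is a finite, possibly empty, sequence of local flips that transforms $T_1$ into $T_2$, with every intermediate result a domino tiling of $R$. -/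

import Mathlib

namespace DominoTiling

/-- An elementary square of the plane, given by its lower left corner `(i, j)`: it stands for
`[i, i+1] × [j, j+1]`. -/
abbrev Square : Type := ℤ × ℤ

/-- The closed unit square of the plane with lower left corner `c`. -/
def Square.toSet (c : Square) : Set (ℝ × ℝ) :=
  Set.Icc (c.1 : ℝ) (c.1 + 1) ×ˢ Set.Icc (c.2 : ℝ) (c.2 + 1)

/-- The four one-dimensional faces (bottom, top, left, right) of an elementary square, each given
by its two end points. -/
def Square.faces (c : Square) : Finset ((ℤ × ℤ) × (ℤ × ℤ)) :=
  {((c.1, c.2), (c.1 + 1, c.2)), ((c.1, c.2 + 1), (c.1 + 1, c.2 + 1)),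
    ((c.1, c.2), (c.1, c.2 + 1)), ((c.1 + 1, c.2), (c.1 + 1, c.2 + 1))}

/-- Two different elementary squares are adjacent if they have a one-dimensional face in common. -/
def Square.Adjacent (c d : Square) : Prop :=
  c ≠ d ∧ (c.faces ∩ d.faces).Nonempty

/-- A 2-dimensional cubiculated region of the plane (a finite cubical complex in the plane all of
whose maximal cells are elementary squares), given by its finite set of elementary squares. -/
abbrev Region : Type := Finset Square

/-- The underlying closed subset of the plane: the union of the closed squares of the region. -/
def Region.toSet (R : Region) : Set (ℝ × ℝ) :=
  ⋃ c ∈ R, Square.toSet c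

/-- Every simple closed curve in `X` can be shrunk to a point continuously in `X`. A closed curve
is a path from a point to itself; it is simple if it is injective up to its two end times. -/
def SimplyConnected (X : Set (ℝ × ℝ)) : Prop :=
  ∀ (x : X) (γ : Path x x), Set.InjOn γ (Set.Ico 0 1) → γ.Homotopic (Path.refl x)

/-- A domino: two adjacent elementary squares. -/
def IsDomino (d : Finset Square) : Prop :=
  ∃ a b : Square, a.Adjacent b ∧ d = {a, b}

/-- The set of dominoes contained in the region `R`. -/
def dominoes (R : Region) : Set (Finset Square) :=
  {d | IsDomino d ∧ d ⊆ R}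

/-- A domino tiling of `R`: a set of dominoes contained in `R` such that every elementary square
of `R` is covered exactly once. -/
def IsTiling (R : Region) (T : Finset (Finset Square)) : Prop :=
  (∀ d ∈ T, d ∈ dominoes R) ∧ ∀ c ∈ R, ∃! d, d ∈ T ∧ c ∈ d

/-- The two adjacent parallel horizontal dominoes that fill the `2 × 2` block whose lower left
square is `c`. -/
def horizontalPair (c : Square) : Finset (Finset Square) :=
  {{(c.1, c.2), (c.1 + 1, c.2)}, {(c.1, c.2 + 1), (c.1 + 1, c.2 + 1)}}

/-- The two adjacent parallel vertical dominoes that fill the `2 × 2` block whose lower left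
square is `c`. -/
def verticalPair (c : Square) : Finset (Finset Square) :=
  {{(c.1, c.2), (c.1, c.2 + 1)}, {(c.1 + 1, c.2), (c.1 + 1, c.2 + 1)}}

/-- The local flip moves of `R`: pairs `(D₁, D₂)` of sets of dominoes of `R`, where `D₁` consists of
two adjacent parallel dominoes and `D₂` of the two perpendicular dominoes on the same squares. -/
def flipMoves (R : Region) : Set (Finset (Finset Square) × Finset (Finset Square)) :=
  {M | (∀ d ∈ M.1 ∪ M.2, d ∈ dominoes R) ∧
    ∃ c : Square, M = (horizontalPair c, verticalPair c) ∨ M = (verticalPair c, horizontalPair c)}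

/-- `T'` is a tiling of `R` that arises from `T` by performing one local flip. -/
def FlipStep (R : Region) (T T' : Finset (Finset Square)) : Prop :=
  IsTiling R T' ∧ ∃ M ∈ flipMoves R, M.1 ⊆ T ∧ T' = (T \ M.1) ∪ M.2

/-- `T₂` is obtained from `T₁` by a finite (possibly empty) sequence of local flips, all of whose
intermediate results are tilings of `R`. -/
def FlipConnected (R : Region) (T₁ T₂ : Finset (Finset Square)) : Prop :=
  Relation.ReflTransGen (FlipStep R) T₁ T₂

end DominoTiling

/-! Thurston's height functions drive the proof. Going round a square of `R`, let the height change
by 1 along an edge that no domino of `T` crosses and by -3 along a crossed one, with signs from the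
checkerboard colouring. One domino covers each square, so the changes cancel, and simple
connectedness yields a height `H` on the edges of `R` (`IsTiling.exists_height`). A quarter of the
difference of the heights of two tilings is an integer function `d` on the whole grid, and `d = 0`
only for equal tilings.

Topology enters only through `sum_crossing_eq_zero`: a simple cycle of edges in `R` has winding
number zero around the centre of a square outside `R`. This produces integer vortices
(`exists_vortex`): edge functions that vanish on `R` and have curl 1 at one prescribed outside
square. They serve twice. Subtracting vortices makes a field with no curl on `R` curl-free on all of
`ℤ²` (`exists_region_potential`). Summation by parts against a vortex shows that `d`, normalized to
0 at infinity, vanishes at the corners of outside squares (`ConstantOffInterior.eq_zero`); this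
works even if `R` is disconnected.

Where `σ * d` is positive, for a sign `σ`, a point of maximal `σ * H` is surrounded by two parallel
dominoes of `T₁`. Flipping them moves `d` towards 0 at that point alone
(`IsHeightDifference.exists_flip`), so `∑ |d|` decreases and induction finishes the proof. -/

namespace DominoTiling

/-! ### Potentials on graphs and on the grid -/

section Potential

variable {V : Type*} {G : SimpleGraph V} {A : Type*} [AddCommGroup A]

/-- If an antisymmetric weight sums to zero over all simple cycles of a graph, then it sums to zero
over all closed sequences of adjacent vertices. -/
theorem sum_closed_eq_zero (ω : V → V → A) (hω : ∀ u v, ω v u = -ω u v)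
    (hsimple : ∀ (n : ℕ) (v : ℕ → V), 3 ≤ n → v n = v 0 → Set.InjOn v (Set.Iio n) →
      (∀ k < n, G.Adj (v k) (v (k + 1))) → ∑ k ∈ Finset.range n, ω (v k) (v (k + 1)) = 0)
    (n : ℕ) (v : ℕ → V) (hn : v n = v 0) (hv : ∀ k < n, G.Adj (v k) (v (k + 1))) :
    ∑ k ∈ Finset.range n, ω (v k) (v (k + 1)) = 0 := by
  induction n using Nat.strong_induction_on generalizing v with
  | _ n ih =>
  by_cases hinj : Set.InjOn v (Set.Iio n)
  · rcases Nat.lt_or_ge n 3 with h | h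
    · interval_cases n
      · simp
      · exact absurd (hv 0 one_pos) (by rw [zero_add, hn]; exact G.loopless.irrefl _)
      -- An edge run forth and back cancels by antisymmetry, so `hsimple` is needed only from length
      -- 3 on.
      · simp only [Finset.sum_range_succ, Finset.sum_range_zero, zero_add]
        rw [show (1 + 1 : ℕ) = 2 from rfl, hn, hω (v 0) (v 1)]
        simp
    · exact hsimple n v h hn hinj hv
  · obtain ⟨i, j, hij, hjn, hvij⟩ : ∃ i j, i < j ∧ j < n ∧ v i = v j := by
      simp only [Set.InjOn, not_forall] at hinj
      obtain ⟨i, hi, j, hj, h, hne⟩ := hinj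
      rcases Nat.lt_or_gt_of_ne hne with h' | h'
      · exact ⟨i, j, h', hj, h⟩
      · exact ⟨j, i, h', hi, h.symm⟩
    obtain ⟨l, rfl⟩ := Nat.exists_eq_add_of_lt hij
    obtain ⟨m, rfl⟩ := Nat.exists_eq_add_of_lt hjn
    -- The repeated vertex splits the sequence into the loop from `i` to `j` and the rest with that
    -- loop cut out; both are closed and shorter.
    have h1 := ih (l + 1) (by omega) (fun k ↦ v (i + k)) (by simp [hvij, add_assoc])
      (fun k hk ↦ hv (i + k) (by omega))
    have h2 := ih (i + (m + 1)) (by omega) (fun k ↦ if k ≤ i then v k else v (k + (l + 1)))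
      (by simp; rw [← hn]; congr 1; omega) (by
        intro k hk
        rcases lt_trichotomy k i with h | rfl | h
        · simpa [h.le, Nat.succ_le_of_lt h] using hv k (by omega)
        · have := hv (k + l + 1) (by omega)
          simp only [le_refl, if_true, hvij, show ¬ k + 1 ≤ k by omega, if_false]
          convert this using 2; omega
        · have := hv (k + (l + 1)) (by omega)
          simp only [show ¬ k ≤ i by omega, show ¬ k + 1 ≤ i by omega, if_false]
          convert this using 2; omega)
    rw [show i + l + 1 + m + 1 = i + (l + 1) + (m + 1) by omega, Finset.sum_range_add,
      Finset.sum_range_add]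
    rw [Finset.sum_range_add] at h2
    have e1 : ∑ k ∈ Finset.range i, ω (v k) (v (k + 1)) =
        ∑ k ∈ Finset.range i, ω (if k ≤ i then v k else v (k + (l + 1)))
          (if k + 1 ≤ i then v (k + 1) else v (k + 1 + (l + 1))) := by
      refine Finset.sum_congr rfl fun k hk ↦ ?_
      have := Finset.mem_range.1 hk
      simp [this.le, Nat.succ_le_of_lt this]
    have e2 : ∑ k ∈ Finset.range (m + 1), ω (v (i + (l + 1) + k)) (v (i + (l + 1) + k + 1)) =
        ∑ k ∈ Finset.range (m + 1), ω (if i + k ≤ i then v (i + k) else v (i + k + (l + 1)))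
          (if i + k + 1 ≤ i then v (i + k + 1) else v (i + k + 1 + (l + 1))) := by
      refine Finset.sum_congr rfl fun k hk ↦ ?_
      rw [if_neg (show ¬ i + k + 1 ≤ i by omega)]
      rcases Nat.eq_zero_or_pos k with rfl | hk
      · simp only [add_zero, le_refl, if_true, hvij]
        congr 2; omega
      · rw [if_neg (by omega)]
        congr 2 <;> omega
    rw [e1, e2, ← h2]
    have h1' : ∑ k ∈ Finset.range (l + 1), ω (v (i + k)) (v (i + k + 1)) = 0 := h1
    rw [h1', add_zero]

/-- An antisymmetric weight on the edges of a graph that sums to zero over all simple cycles is the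
difference of a potential. -/
theorem exists_potential (ω : V → V → A) (hω : ∀ u v, ω v u = -ω u v)
    (hsimple : ∀ (n : ℕ) (v : ℕ → V), 3 ≤ n → v n = v 0 → Set.InjOn v (Set.Iio n) →
      (∀ k < n, G.Adj (v k) (v (k + 1))) → ∑ k ∈ Finset.range n, ω (v k) (v (k + 1)) = 0) :
    ∃ g : V → A, ∀ u v, G.Adj u v → g v - g u = ω u v := by
  let W : ∀ {u v : V}, G.Walk u v → A := fun p ↦
    ∑ k ∈ Finset.range p.length, ω (p.getVert k) (p.getVert (k + 1))
  have hW : ∀ {u : V} (p : G.Walk u u), W p = 0 := fun p ↦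
    sum_closed_eq_zero ω hω hsimple p.length p.getVert (by simp)
      fun k hk ↦ p.adj_getVert_succ hk
  have happ : ∀ {u v w : V} (p : G.Walk u v) (q : G.Walk v w), W (p.append q) = W p + W q := by
    intro u v w p q
    simp only [W, SimpleGraph.Walk.length_append, Finset.sum_range_add]
    congr 1
    · refine Finset.sum_congr rfl fun k hk ↦ ?_
      have := Finset.mem_range.1 hk
      rw [SimpleGraph.Walk.getVert_append', SimpleGraph.Walk.getVert_append', if_pos this.le,
        if_pos (Nat.succ_le_of_lt this)]
    · refine Finset.sum_congr rfl fun k hk ↦ ?_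
      rw [SimpleGraph.Walk.getVert_append, SimpleGraph.Walk.getVert_append, if_neg (by omega),
        if_neg (by omega)]
      congr 2 <;> omega
  have hone : ∀ {u v : V} (h : G.Adj u v), W h.toWalk = ω u v := by
    intro u v h
    simp [W]
  let r : V → V := fun u ↦ (G.connectedComponentMk u).out
  have hr : ∀ u, G.Reachable (r u) u := fun u ↦
    SimpleGraph.ConnectedComponent.exact (Quot.out_eq _)
  have hrr : ∀ {u v}, G.Adj u v → r u = r v := fun h ↦
    congrArg Quot.out (SimpleGraph.ConnectedComponent.sound h.reachable)
  refine ⟨fun u ↦ W (hr u).some, fun u v h ↦ ?_⟩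
  -- The starting points are kept general because `r u` and `r v` are equal only propositionally,
  -- while walks depend on them.
  have key : ∀ (x y : V) (_ : x = y) (p : G.Walk x u) (q : G.Walk y v), W q - W p = ω u v := by
    rintro x _ rfl p q
    have h1 := hW ((p.append h.toWalk).append q.reverse)
    have h2 := hW (q.append q.reverse)
    rw [happ, happ, hone] at h1
    rw [happ] at h2
    rw [← add_right_cancel (h1.trans h2.symm)]; abel
  exact key _ _ (hrr h) _ _

end Potential

/-- Every function on the integers is the difference of another one. -/
theorem exists_int_primitive {A : Type*} [AddCommGroup A] (f : ℤ → A) :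
    ∃ F : ℤ → A, F 0 = 0 ∧ ∀ x, F (x + 1) - F x = f x := by
  -- `Int.toNat` sends negative integers to 0, so at most one of the two sums is nonempty.
  refine ⟨fun x ↦ (∑ i ∈ Finset.range x.toNat, f i) -
    ∑ i ∈ Finset.range (-x).toNat, f (-(i : ℤ) - 1), by simp, fun x ↦ ?_⟩
  dsimp only
  obtain ⟨n, rfl | rfl⟩ := x.eq_nat_or_neg
  · rw [show ((n : ℤ) + 1).toNat = n + 1 by omega, show (-((n : ℤ) + 1)).toNat = 0 by omega,
      show (-(n : ℤ)).toNat = 0 by omega, Int.toNat_natCast, Finset.sum_range_succ]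
    simp
  · cases n with
    | zero => simp
    | succ m =>
      rw [show (-((m + 1 : ℕ) : ℤ) + 1).toNat = 0 by omega,
        show (-(-((m + 1 : ℕ) : ℤ) + 1)).toNat = m by omega,
        show (-((m + 1 : ℕ) : ℤ)).toNat = 0 by omega,
        show (-(-((m + 1 : ℕ) : ℤ))).toNat = m + 1 by omega, Finset.sum_range_succ]
      simp [sub_eq_add_neg, add_comm]

/-- A curl-free pair of edge functions on the grid `ℤ²` (`a` on horizontal and `b` on vertical
edges, indexed by their lower left ends) is the gradient of a potential. -/
theorem exists_grid_potential {A : Type*} [AddCommGroup A] (a b : ℤ → ℤ → A)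
    (h : ∀ x y, a x y + b (x + 1) y - a x (y + 1) - b x y = 0) :
    ∃ H : ℤ → ℤ → A, (∀ x y, H (x + 1) y - H x y = a x y) ∧
      ∀ x y, H x (y + 1) - H x y = b x y := by
  obtain ⟨P, -, hP⟩ := exists_int_primitive fun x ↦ a x 0
  choose Q hQ0 hQ using fun x ↦ exists_int_primitive (b x)
  -- Integrate along the horizontal axis, then vertically.
  refine ⟨fun x y ↦ P x + Q x y, fun x y ↦ ?_, fun x y ↦ ?_⟩
  -- The error in the horizontal equation does not depend on `y`, by the curl condition, and it
  -- vanishes on the axis.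
  · have step : ∀ y, (P (x + 1) + Q (x + 1) (y + 1) - (P x + Q x (y + 1)) - a x (y + 1)) =
        (P (x + 1) + Q (x + 1) y - (P x + Q x y) - a x y) := by
      intro y
      rw [← sub_eq_zero, ← h x y, ← hQ x y, ← hQ (x + 1) y]
      abel
    rw [← sub_eq_zero]
    induction y using Int.induction_on with
    | zero => simp [hQ0, hP]
    | succ i hi => rw [step, hi]
    | pred i hi => rw [← step, sub_add_cancel, hi]
  · rw [← hQ x y, add_sub_add_left_eq_sub]

/-! ### Edges of a region and their realization in the plane -/

/-- One of the two squares along the horizontal edge from `(x, y)` to `(x + 1, y)` lies in `R`. -/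
def HEdge (R : Region) (x y : ℤ) : Prop := (x, y) ∈ R ∨ (x, y - 1) ∈ R

/-- One of the two squares along the vertical edge from `(x, y)` to `(x, y + 1)` lies in `R`. -/
def VEdge (R : Region) (x y : ℤ) : Prop := (x, y) ∈ R ∨ (x - 1, y) ∈ R

/-- `v` is the right or the upper neighbour of the grid point `u`. -/
def GridStep (u v : ℤ × ℤ) : Prop := v = (u.1 + 1, u.2) ∨ v = (u.1, u.2 + 1)

/-- `v` is a neighbour of the grid point `u`. -/
def GridAdj (u v : ℤ × ℤ) : Prop := GridStep u v ∨ GridStep v u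

/-- There is an edge of the region `R` from `u` to its right or upper neighbour `v`. -/
def RegionStep (R : Region) (u v : ℤ × ℤ) : Prop :=
  (v = (u.1 + 1, u.2) ∧ HEdge R u.1 u.2) ∨ (v = (u.1, u.2 + 1) ∧ VEdge R u.1 u.2)

theorem RegionStep.gridStep {R : Region} {u v : ℤ × ℤ} (h : RegionStep R u v) : GridStep u v :=
  h.imp And.left And.left

/-- The graph formed by the edges of the squares of a region. -/
def skeleton (R : Region) : SimpleGraph (ℤ × ℤ) where
  Adj u v := RegionStep R u v ∨ RegionStep R v u
  symm := ⟨fun _ _ h ↦ h.symm⟩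
  loopless := ⟨fun u h ↦ by
    simp [RegionStep, Prod.ext_iff] at h⟩

theorem skeleton_gridAdj {R : Region} {u v : ℤ × ℤ} (h : (skeleton R).Adj u v) : GridAdj u v :=
  h.imp RegionStep.gridStep RegionStep.gridStep

/-- The piecewise linear function with values `f 0, …, f n` at `0, …, n`. -/
noncomputable def interpolate (f : ℕ → ℤ) (n : ℕ) (t : ℝ) : ℝ :=
  f 0 + ∑ k ∈ Finset.range n, max 0 (min 1 (t - k)) * (f (k + 1) - f k)

theorem continuous_interpolate (f : ℕ → ℤ) (n : ℕ) : Continuous (interpolate f n) := by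
  unfold interpolate
  fun_prop

/-- At time `t` in `[k, k + 1]` the clamped factors are 1 before index `k` and 0 after it, so only
the `k`-th increment is partial. -/
theorem interpolate_eq (f : ℕ → ℤ) {n k : ℕ} (hk : k < n) {t : ℝ} (h0 : k ≤ t) (h1 : t ≤ k + 1) :
    interpolate f n t = f k + (t - k) * (f (k + 1) - f k) := by
  obtain ⟨m, rfl⟩ := Nat.exists_eq_add_of_lt hk
  have e1 : ∑ j ∈ Finset.range k, max 0 (min 1 (t - j)) * ((f (j + 1) : ℝ) - f j) = f k - f 0 := by
    rw [← Finset.sum_range_sub (fun j ↦ (f j : ℝ)) k]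
    refine Finset.sum_congr rfl fun j hj ↦ ?_
    have : (j : ℝ) + 1 ≤ k := by exact_mod_cast Finset.mem_range.1 hj
    rw [min_eq_left (by linarith), max_eq_right zero_le_one, one_mul]
  have e2 : ∑ j ∈ Finset.range m, max 0 (min 1 (t - (k + 1 + j : ℕ))) *
      ((f (k + 1 + j + 1) : ℝ) - f (k + 1 + j)) = 0 := by
    refine Finset.sum_eq_zero fun j _ ↦ ?_
    have : (0 : ℝ) ≤ j := j.cast_nonneg
    push_cast
    rw [max_eq_left (min_le_of_right_le (by linarith)), zero_mul]
  rw [interpolate, show k + m + 1 = k + 1 + m by omega, Finset.sum_range_add,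
    Finset.sum_range_succ, e1, e2, min_eq_right (by linarith), max_eq_right (by linarith)]
  ring

/-- The point of the segment from `u` to `v` at time `s`. -/
noncomputable def segmentPoint (u v : ℤ × ℤ) (s : ℝ) : ℝ × ℝ :=
  (u.1 + s * (v.1 - u.1), u.2 + s * (v.2 - u.2))

theorem segmentPoint_symm (u v : ℤ × ℤ) (s : ℝ) : segmentPoint u v s = segmentPoint v u (1 - s) := by
  ext <;> simp only [segmentPoint] <;> ring

theorem segmentPoint_mem {R : Region} {u v : ℤ × ℤ} (h : (skeleton R).Adj u v) {s : ℝ}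
    (hs : s ∈ Set.Icc (0 : ℝ) 1) : segmentPoint u v s ∈ R.toSet := by
  wlog h' : RegionStep R u v generalizing u v s
  · rw [segmentPoint_symm]
    exact this h.symm ⟨by linarith [hs.2], by linarith [hs.1]⟩ (h.resolve_left h')
  obtain ⟨h0, h1⟩ := hs
  simp only [Region.toSet, Set.mem_iUnion, exists_prop]
  rcases h' with ⟨rfl, h | h⟩ | ⟨rfl, h | h⟩ <;>
    exact ⟨_, h, by constructor <;> constructor <;> simp [segmentPoint] <;> linarith⟩

/-- Points on two edges of the grid (each without its end) coincide only if the edges have the same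
start or are opposite. -/
theorem eq_or_of_segmentPoint_eq {u v u' v' : ℤ × ℤ} (h : GridAdj u v) (h' : GridAdj u' v')
    {s s' : ℝ} (hs : s ∈ Set.Ico (0 : ℝ) 1) (hs' : s' ∈ Set.Ico (0 : ℝ) 1)
    (heq : segmentPoint u v s = segmentPoint u' v' s') : u = u' ∨ (u = v' ∧ v = u') := by
  obtain ⟨a, b⟩ := u
  obtain ⟨c, d⟩ := v
  obtain ⟨a', b'⟩ := u'
  obtain ⟨c', d'⟩ := v'
  obtain ⟨h0, h1⟩ := hs
  obtain ⟨h0', h1'⟩ := hs'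
  simp only [segmentPoint, Prod.mk.injEq] at heq
  obtain ⟨e1, e2⟩ := heq
  -- Each point is at distance less than 1 from the start of its edge, so the two starts differ by
  -- at most 1 in each coordinate; finitely many cases remain.
  have key : ∀ x y : ℤ, (x : ℝ) < y + 2 → (y : ℝ) < x + 2 → x = y - 1 ∨ x = y ∨ x = y + 1 := by
    intro x y h h'
    have h1 : x < y + 2 := by exact_mod_cast h
    have h2 : y < x + 2 := by exact_mod_cast h'
    omega
  have dir : ∀ {a b c d : ℤ}, GridAdj (a, b) (c, d) → (c = a + 1 ∧ d = b) ∨ (c = a ∧ d = b + 1) ∨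
      (c = a - 1 ∧ d = b) ∨ (c = a ∧ d = b - 1) := by
    intro a b c d h
    simp only [GridAdj, GridStep, Prod.mk.injEq] at h
    omega
  simp only [Prod.mk.injEq]
  rcases dir h with ⟨hc, hd⟩ | ⟨hc, hd⟩ | ⟨hc, hd⟩ | ⟨hc, hd⟩ <;>
  rcases dir h' with ⟨hc', hd'⟩ | ⟨hc', hd'⟩ | ⟨hc', hd'⟩ | ⟨hc', hd'⟩ <;>
  rw [hc, hc'] at e1 <;> rw [hd, hd'] at e2 <;>
  push_cast at e1 e2 <;>
  rcases key a a' (by linarith) (by linarith) with rfl | rfl | rfl <;>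
  rcases key b b' (by linarith) (by linarith) with rfl | rfl | rfl <;>
  first
  | omega
  | (exfalso; push_cast at e1 e2; linarith)

/-! ### Winding around the centre of a square -/

/-- The vector from the centre of the square `c` to a point, as a complex number. -/
noncomputable def fromCenter (c : Square) (z : ℝ × ℝ) : ℂ := ⟨z.1 - (c.1 + 1 / 2), z.2 - (c.2 + 1 / 2)⟩

theorem continuous_fromCenter (c : Square) : Continuous (fromCenter c) := by
  have : fromCenter c = fun z ↦ ((z.1 - (c.1 + 1 / 2) : ℝ) : ℂ) +
      ((z.2 - (c.2 + 1 / 2) : ℝ) : ℂ) * Complex.I := by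
    funext z
    apply Complex.ext <;> simp [fromCenter]
  rw [this]
  fun_prop

/-- The centre of a square lies in no other closed elementary square. -/
theorem fromCenter_ne_zero {R : Region} {c : Square} (hc : c ∉ R) {z : ℝ × ℝ} (hz : z ∈ R.toSet) :
    fromCenter c z ≠ 0 := by
  intro h
  simp only [Region.toSet, Set.mem_iUnion, exists_prop] at hz
  obtain ⟨d, hd, ⟨h1, h2⟩, h3, h4⟩ := hz
  have e1 : z.1 - (c.1 + 1 / 2) = 0 := congrArg Complex.re h
  have e2 : z.2 - (c.2 + 1 / 2) = 0 := congrArg Complex.im h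
  have i1 : d.1 < c.1 + 1 := by exact_mod_cast (by linarith : (d.1 : ℝ) < c.1 + 1)
  have i2 : c.1 < d.1 + 1 := by exact_mod_cast (by linarith : (c.1 : ℝ) < d.1 + 1)
  have i3 : d.2 < c.2 + 1 := by exact_mod_cast (by linarith : (d.2 : ℝ) < c.2 + 1)
  have i4 : c.2 < d.2 + 1 := by exact_mod_cast (by linarith : (c.2 : ℝ) < d.2 + 1)
  exact hc ((Prod.ext (by omega) (by omega) : c = d) ▸ hd)

/-- The signed number of times that the edge from `u` to `v` crosses the leftward ray from the
centre of the square `c`. -/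
def crossing (c : Square) (u v : ℤ × ℤ) : ℤ :=
  if u.1 ≤ c.1 ∧ v.1 ≤ c.1 then (if c.2 < v.2 then 1 else 0) - (if c.2 < u.2 then 1 else 0) else 0

theorem crossing_symm (c : Square) (u v : ℤ × ℤ) : crossing c v u = -crossing c u v := by
  unfold crossing
  split_ifs <;> simp_all

/-- Along an edge of the grid there is a continuous branch of the argument; it changes by the
difference of the principal arguments, corrected by the crossing number. -/
theorem exists_branch (c : Square) {u v : ℤ × ℤ} (h : GridAdj u v) :
    ∃ ε : ℂ, (∀ s ∈ Set.Icc (0 : ℝ) 1, ε * fromCenter c (segmentPoint u v s) ∈ Complex.slitPlane) ∧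
      (ε * fromCenter c (segmentPoint u v 1)).arg - (ε * fromCenter c (segmentPoint u v 0)).arg =
      (fromCenter c (segmentPoint u v 1)).arg - (fromCenter c (segmentPoint u v 0)).arg -
        2 * Real.pi * crossing c u v := by
  wlog h' : GridStep u v generalizing u v
  · obtain ⟨ε, h1, h2⟩ := this h.symm (h.resolve_left h')
    refine ⟨ε, fun s hs ↦ ?_, ?_⟩
    · rw [segmentPoint_symm]
      exact h1 _ ⟨by linarith [hs.2], by linarith [hs.1]⟩
    · rw [segmentPoint_symm u v, segmentPoint_symm u v, crossing_symm c v u]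
      simp only [sub_self, sub_zero] at h2 ⊢
      push_cast
      linarith
  obtain ⟨x, y⟩ := u
  obtain ⟨p, q⟩ := c
  -- The leftward ray is the branch cut of `Complex.arg`. An edge that crosses it is moved by the
  -- factor -1 into the right half-plane.
  by_cases hc : v = (x, y + 1) ∧ x ≤ p ∧ y = q
  · obtain ⟨rfl, hx, rfl⟩ := hc
    have hx' : (x : ℝ) ≤ p := by exact_mod_cast hx
    refine ⟨-1, fun s hs ↦ ?_, ?_⟩
    · left
      simp [fromCenter, segmentPoint]
      linarith
    · rw [neg_one_mul, neg_one_mul, Complex.arg_neg_eq_arg_sub_pi_of_im_pos,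
        Complex.arg_neg_eq_arg_add_pi_of_im_neg]
      · simp [crossing, hx]; ring
      · simp [fromCenter, segmentPoint]
      · simp [fromCenter, segmentPoint]; norm_num
  -- All other edges avoid the cut: its height `q + 1 / 2` is not an integer, and a vertical edge
  -- that reaches this height lies to the right of the centre.
  · refine ⟨1, fun s hs ↦ ?_, ?_⟩
    · rw [one_mul, Complex.mem_slitPlane_iff]
      obtain ⟨hs0, hs1⟩ := hs
      rcases h' with rfl | rfl
      · right
        simp only [fromCenter, segmentPoint, sub_self, mul_zero, add_zero]
        intro h
        have : 2 * y = 2 * q + 1 := by exact_mod_cast (by linarith : (2 * y : ℝ) = 2 * q + 1)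
        omega
      · rcases lt_or_ge p x with hx | hx
        · left
          have hx' : (p : ℝ) + 1 ≤ x := by exact_mod_cast hx
          simp [fromCenter, segmentPoint]
          linarith
        · right
          simp only [fromCenter, segmentPoint]
          push_cast
          rcases lt_trichotomy y q with hy | hy | hy
          · have : (y : ℝ) + 1 ≤ q := by exact_mod_cast hy
            intro h
            linarith
          · exact absurd ⟨rfl, hx, hy⟩ hc
          · have : (q : ℝ) + 1 ≤ y := by exact_mod_cast hy
            intro h
            linarith
    · have : crossing (p, q) (x, y) v = 0 := by
        rcases h' with rfl | rfl
        · simp [crossing]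
        · simp only [true_and, not_and] at hc
          simp only [crossing]
          split_ifs <;> omega
      simp [this]

/-- A continuous logarithm along an edge of the grid. -/
theorem log_difference (c : Square) {u v : ℤ × ℤ} (h : GridAdj u v) {L : ℝ → ℂ}
    (hL : ContinuousOn L (Set.Icc 0 1))
    (hexp : ∀ s ∈ Set.Icc (0 : ℝ) 1, Complex.exp (L s) = fromCenter c (segmentPoint u v s)) :
    (L 1).im - (L 0).im =
      (fromCenter c (segmentPoint u v 1)).arg - (fromCenter c (segmentPoint u v 0)).arg -
        2 * Real.pi * crossing c u v := by
  obtain ⟨ε, h1, h2⟩ := exists_branch c h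
  set z : ℝ → ℂ := fun s ↦ ε * fromCenter c (segmentPoint u v s) with hz
  have hzc : Continuous z := by
    refine continuous_const.mul ((continuous_fromCenter c).comp ?_)
    unfold segmentPoint
    fun_prop
  have h01 : (0 : ℝ) ∈ Set.Icc (0 : ℝ) 1 := ⟨le_rfl, zero_le_one⟩
  have h11 : (1 : ℝ) ∈ Set.Icc (0 : ℝ) 1 := ⟨zero_le_one, le_rfl⟩
  have hz0 : ∀ s ∈ Set.Icc (0 : ℝ) 1, z s ≠ 0 := fun s hs ↦ Complex.slitPlane_ne_zero (h1 s hs)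
  -- `L` and a translate of the principal logarithm of `z` lift the same path through `exp` and
  -- agree at 0, hence everywhere.
  have := Complex.isCoveringMap_exp.eqOn_of_comp_eqOn (isPreconnected_Icc (a := (0 : ℝ)) (b := 1))
    (g₁ := L) (g₂ := fun s ↦ Complex.log (z s) + (L 0 - Complex.log (z 0))) hL
    ((hzc.continuousOn.clog h1).add continuousOn_const) (fun s hs ↦ by
      apply Subtype.ext
      simp only [Function.comp_apply]
      rw [Complex.exp_add, Complex.exp_sub, Complex.exp_log (hz0 s hs), Complex.exp_log (hz0 0 h01),
        hexp s hs, hexp 0 h01]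
      have h3 := hz0 0 h01
      simp only [hz, ne_eq, mul_eq_zero, not_or] at h3 ⊢
      field_simp [h3.1, h3.2]) h01 (by simp)
  have h3 := this h11
  have h4 : (L 1).im = (z 1).arg + ((L 0).im - (z 0).arg) := by
    rw [h3]; simp [Complex.log_im]
  rw [← h2, h4]
  ring

/-- A null-homotopic loop in a subset of the plane has, with respect to any nowhere vanishing
complex function, a closed continuous logarithm. -/
theorem exists_closed_log {X : Type*} [TopologicalSpace X] {x : X} {γ : Path x x}
    (hγ : γ.Homotopic (Path.refl x)) {F : X → ℂ} (hF : Continuous F) (hF0 : ∀ z, F z ≠ 0) :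
    ∃ L : C(unitInterval, ℂ), (∀ t, Complex.exp (L t) = F (γ t)) ∧ L 0 = L 1 := by
  let F' : C(X, {z : ℂ // z ≠ 0}) := ⟨fun z ↦ ⟨F z, hF0 z⟩, hF.subtype_mk hF0⟩
  let δ := γ.map F'.continuous
  have hδ : δ.Homotopic (Path.refl (F' x)) := by
    have h : (Path.refl x).map F'.continuous = Path.refl (F' x) := rfl
    exact h ▸ hγ.map F'
  have h0 : F' x = (⟨_, (Complex.log (F x)).exp_ne_zero⟩ : {z : ℂ // z ≠ 0}) :=
    Subtype.ext (Complex.exp_log (hF0 x)).symm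
  have hl := Complex.isCoveringMap_exp.liftPath_lifts δ.toContinuousMap (Complex.log (F x))
    (δ.source.trans h0)
  refine ⟨Complex.isCoveringMap_exp.liftPath δ.toContinuousMap (Complex.log (F x))
    (δ.source.trans h0), fun t ↦ congrArg Subtype.val (congrFun hl t), ?_⟩
  -- Homotopic paths have lifts with the same end, and the constant path lifts to a constant.
  rw [Complex.isCoveringMap_exp.liftPath_apply_one_eq_of_homotopicRel hδ (Complex.log (F x))
    (δ.source.trans h0) h0, Complex.isCoveringMap_exp.liftPath_zero]
  exact (congr($(Complex.isCoveringMap_exp.liftPath_const h0) 1)).symm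

/-! ### Cycles of edges as simple closed curves -/

/-- The polygon through the grid points `v 0, …, v n`, parametrized by `[0, n]`. -/
noncomputable def polygon (v : ℕ → ℤ × ℤ) (n : ℕ) (t : ℝ) : ℝ × ℝ :=
  (interpolate (fun k ↦ (v k).1) n t, interpolate (fun k ↦ (v k).2) n t)

theorem continuous_polygon (v : ℕ → ℤ × ℤ) (n : ℕ) : Continuous (polygon v n) :=
  (continuous_interpolate _ n).prodMk (continuous_interpolate _ n)

theorem polygon_eq (v : ℕ → ℤ × ℤ) {n k : ℕ} (hk : k < n) {t : ℝ} (h0 : k ≤ t) (h1 : t ≤ k + 1) :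
    polygon v n t = segmentPoint (v k) (v (k + 1)) (t - k) := by
  rw [polygon, interpolate_eq _ hk h0 h1, interpolate_eq _ hk h0 h1, segmentPoint]

theorem exists_segment {n : ℕ} (hn : 0 < n) {t : ℝ} (ht : t ∈ Set.Icc (0 : ℝ) n) :
    ∃ k < n, (k : ℝ) ≤ t ∧ t ≤ k + 1 := by
  rcases ht.2.lt_or_eq with h | rfl
  · exact ⟨⌊t⌋₊, (Nat.floor_lt ht.1).2 h, Nat.floor_le ht.1, (Nat.lt_floor_add_one t).le⟩
  · obtain ⟨m, rfl⟩ := Nat.exists_eq_succ_of_ne_zero hn.ne'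
    exact ⟨m, by omega, by simp, by simp⟩

theorem polygon_mem {R : Region} {n : ℕ} (hn : 0 < n) {v : ℕ → ℤ × ℤ}
    (hv : ∀ k < n, (skeleton R).Adj (v k) (v (k + 1))) {t : ℝ} (ht : t ∈ Set.Icc (0 : ℝ) n) :
    polygon v n t ∈ R.toSet := by
  obtain ⟨k, hk, h0, h1⟩ := exists_segment hn ht
  rw [polygon_eq v hk h0 h1]
  exact segmentPoint_mem (hv k hk) ⟨by linarith, by linarith⟩

/-- Two half-open edges can meet without having the same start only if they are opposite; in a cycle
without repeated vertices this would make the indices `k` and `k'` successors of each other modulo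
`n`, which `3 ≤ n` excludes. -/
theorem polygon_injOn {n : ℕ} (hn : 3 ≤ n) {v : ℕ → ℤ × ℤ} (hclosed : v n = v 0)
    (hinj : Set.InjOn v (Set.Iio n)) (hv : ∀ k < n, GridAdj (v k) (v (k + 1))) :
    Set.InjOn (polygon v n) (Set.Ico 0 n) := by
  intro t ht t' ht' h
  have hk : ⌊t⌋₊ < n := (Nat.floor_lt ht.1).2 ht.2
  have hk' : ⌊t'⌋₊ < n := (Nat.floor_lt ht'.1).2 ht'.2
  have h0 := Nat.floor_le ht.1
  have h0' := Nat.floor_le ht'.1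
  have h1 := Nat.lt_floor_add_one t
  have h1' := Nat.lt_floor_add_one t'
  generalize ⌊t⌋₊ = k at *
  generalize ⌊t'⌋₊ = k' at *
  rw [polygon_eq v hk h0 h1.le, polygon_eq v hk' h0' h1'.le] at h
  have hmod : ∀ k < n, ∃ l < n, v (k + 1) = v l ∧ (l = k + 1 ∨ (l = 0 ∧ k + 1 = n)) := by
    intro k hk
    rcases Nat.lt_or_ge (k + 1) n with h | h
    · exact ⟨k + 1, h, rfl, .inl rfl⟩
    · have : k + 1 = n := by omega
      exact ⟨0, by omega, by rw [this, hclosed], .inr ⟨rfl, this⟩⟩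
  rcases eq_or_of_segmentPoint_eq (hv k hk) (hv k' hk') ⟨by linarith, by linarith⟩
    ⟨by linarith, by linarith⟩ h with e | ⟨e1, e2⟩
  · obtain rfl := hinj hk hk' e
    simp only [segmentPoint, Prod.mk.injEq, add_right_inj, mul_eq_mul_right_iff, sub_left_inj,
      sub_eq_zero, Int.cast_inj] at h
    by_contra hne
    have e3 := h.1.resolve_left hne
    have e4 := h.2.resolve_left hne
    have := hv k hk
    simp only [GridAdj, GridStep, Prod.ext_iff] at this
    omega
  · obtain ⟨l, hl, el, hl2⟩ := hmod k hk
    obtain ⟨l', hl', el', hl2'⟩ := hmod k' hk'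
    have := hinj hk hl' (e1.trans el')
    have := hinj hl hk' (el.symm.trans e2)
    omega

/-- In a simply connected region, a simple closed cycle of edges does not wind around a square
outside the region. -/
theorem sum_crossing_eq_zero {R : Region} (hR : SimplyConnected R.toSet) {c : Square} (hc : c ∉ R)
    {n : ℕ} {v : ℕ → ℤ × ℤ} (hn : 3 ≤ n) (hclosed : v n = v 0) (hinj : Set.InjOn v (Set.Iio n))
    (hv : ∀ k < n, (skeleton R).Adj (v k) (v (k + 1))) :
    ∑ k ∈ Finset.range n, crossing c (v k) (v (k + 1)) = 0 := by
  have hn0 : 0 < n := by omega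
  have hnR : (0 : ℝ) < n := by exact_mod_cast hn0
  have hscale : ∀ t : unitInterval, (n * t : ℝ) ∈ Set.Icc (0 : ℝ) n := fun t ↦
    ⟨mul_nonneg hnR.le t.2.1, mul_le_of_le_one_right hnR.le t.2.2⟩
  have hv' : ∀ k < n, GridAdj (v k) (v (k + 1)) := fun k hk ↦ skeleton_gridAdj (hv k hk)
  have hvert : ∀ k < n, polygon v n k = segmentPoint (v k) (v (k + 1)) 0 := fun k hk ↦ by
    rw [polygon_eq v hk le_rfl (by linarith), sub_self]
  have hvert' : ∀ k < n, polygon v n (k + 1 : ℕ) = segmentPoint (v k) (v (k + 1)) 1 := fun k hk ↦ by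
    push_cast
    rw [polygon_eq v hk (by linarith) le_rfl, add_sub_cancel_left]
  have hends : polygon v n n = polygon v n 0 := by
    obtain ⟨m, rfl⟩ : ∃ m, n = m + 1 := ⟨n - 1, by omega⟩
    have h2 := hvert 0 (by omega)
    rw [Nat.cast_zero] at h2
    rw [hvert' m (by omega), h2]
    simp [segmentPoint, hclosed]
  let P : ℝ → ℝ × ℝ := polygon v n
  let γ : Path (⟨P 0, polygon_mem hn0 hv ⟨le_rfl, hnR.le⟩⟩ : R.toSet)
      ⟨P 0, polygon_mem hn0 hv ⟨le_rfl, hnR.le⟩⟩ :=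
    { toFun := fun t ↦ ⟨P (n * t), polygon_mem hn0 hv (hscale t)⟩
      continuous_toFun := ((continuous_polygon v n).comp (by fun_prop)).subtype_mk _
      source' := Subtype.ext (by simp)
      target' := Subtype.ext (by simpa using hends) }
  have hγ : Set.InjOn γ (Set.Ico 0 1) := by
    intro t ht t' ht' h
    have h' : P (n * t) = P (n * t') := congrArg Subtype.val h
    have key : ∀ t : unitInterval, t ∈ Set.Ico 0 1 → (n * t : ℝ) ∈ Set.Ico (0 : ℝ) n := fun t ht ↦
      ⟨(hscale t).1, mul_lt_of_lt_one_right hnR ht.2⟩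
    have := polygon_injOn hn hclosed hinj hv' (key t ht) (key t' ht') h'
    exact Subtype.ext (mul_left_cancel₀ hnR.ne' this)
  obtain ⟨L, hL, hL01⟩ := exists_closed_log (hR _ γ hγ) (F := fun z ↦ fromCenter c z.1)
    ((continuous_fromCenter c).comp continuous_subtype_val) fun z ↦ fromCenter_ne_zero hc z.2
  let M : ℝ → ℂ := fun t ↦ L (Set.projIcc 0 1 zero_le_one (t / n))
  have hM : Continuous M := L.continuous.comp (continuous_projIcc.comp (by fun_prop))
  have hMexp : ∀ t ∈ Set.Icc (0 : ℝ) n, Complex.exp (M t) = fromCenter c (P t) := fun t ht ↦ by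
    have ht' : t / n ∈ Set.Icc (0 : ℝ) 1 :=
      ⟨div_nonneg ht.1 hnR.le, (div_le_one hnR).2 ht.2⟩
    simp only [M, hL]
    rw [Set.projIcc_of_mem _ ht']
    show fromCenter c (P (n * (t / n))) = _
    rw [mul_div_cancel₀ _ hnR.ne']
  -- The sum of these differences telescopes, and both the logarithm and the argument return to
  -- their initial values, so the total crossing number is 0.
  have hstep : ∀ k ∈ Finset.range n, ((M (k + 1 : ℕ)).im - (fromCenter c (P (k + 1 : ℕ))).arg) -
      ((M (k : ℕ)).im - (fromCenter c (P (k : ℕ))).arg) =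
        -(2 * Real.pi) * crossing c (v k) (v (k + 1)) := fun k hk ↦ by
    have hk := Finset.mem_range.1 hk
    have hk1 : (k : ℝ) + 1 ≤ n := by exact_mod_cast hk
    have := log_difference c (hv' k hk) (L := fun s ↦ M (k + s))
      (hM.comp (by fun_prop)).continuousOn fun s hs ↦ by
        rw [hMexp _ ⟨by have := hs.1; positivity, by linarith [hs.2]⟩]
        simp only [P]
        rw [polygon_eq v hk (by linarith [hs.1]) (by linarith [hs.2]), add_sub_cancel_left]
    simp only [add_zero] at this
    simp only [P]
    rw [hvert k hk, hvert' k hk]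
    push_cast
    linarith
  have hsum := Finset.sum_congr rfl hstep
  rw [Finset.sum_range_sub (fun k : ℕ ↦ (M k).im - (fromCenter c (P k)).arg), ← Finset.mul_sum] at hsum
  have hM0 : M n = M 0 := by simp [M, hnR.ne', hL01]
  simp only [P] at hsum
  rw [hM0, hends, Nat.cast_zero, sub_self] at hsum
  have := (mul_eq_zero.1 hsum.symm).resolve_left (by simp [Real.pi_ne_zero])
  exact_mod_cast this

/-! ### Vortices and potentials on simply connected regions -/

/-- In a simply connected region, the crossing numbers of edges with the leftward ray from a
square outside the region are the differences of a potential. -/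
theorem exists_crossing_potential {R : Region} (hR : SimplyConnected R.toSet) {c : Square}
    (hc : c ∉ R) : ∃ g : ℤ → ℤ → ℤ, (∀ x y, HEdge R x y → g (x + 1) y - g x y = 0) ∧
      ∀ x y, VEdge R x y → g x (y + 1) - g x y = if x ≤ c.1 ∧ y = c.2 then 1 else 0 := by
  obtain ⟨g, hg⟩ := exists_potential (G := skeleton R) (crossing c) (crossing_symm c)
    fun n v hn h1 h2 h3 ↦ sum_crossing_eq_zero hR hc hn h1 h2 h3
  refine ⟨fun x y ↦ g (x, y), fun x y h ↦ ?_, fun x y h ↦ ?_⟩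
  · rw [hg (x, y) (x + 1, y) (.inl (.inl ⟨rfl, h⟩))]
    simp [crossing]
  · rw [hg (x, y) (x, y + 1) (.inl (.inr ⟨rfl, h⟩))]
    simp only [crossing]
    split_ifs <;> omega

/-- In a simply connected region, every square outside the region carries a unit vortex, that is,
a function on the edges of the grid that vanishes on the edges of the region and whose curl is
concentrated in the given square. -/
theorem exists_vortex {R : Region} (hR : SimplyConnected R.toSet) {c : Square} (hc : c ∉ R) :
    ∃ a b : ℤ → ℤ → ℤ, (∀ x y, HEdge R x y → a x y = 0) ∧ (∀ x y, VEdge R x y → b x y = 0) ∧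
      ∀ x y, a x y + b (x + 1) y - a x (y + 1) - b x y = if (x, y) = c then 1 else 0 := by
  obtain ⟨g, hg1, hg2⟩ := exists_crossing_potential hR hc
  -- The gradient of `g` minus the crossing field. The gradient has no curl, and the crossing field
  -- has curl -1 only at `c`, where the ray starts.
  refine ⟨fun x y ↦ g (x + 1) y - g x y,
    fun x y ↦ g x (y + 1) - g x y - if x ≤ c.1 ∧ y = c.2 then 1 else 0, hg1,
    fun x y h ↦ by simp only [hg2 x y h, sub_self], fun x y ↦ ?_⟩
  simp only [Prod.ext_iff]
  split_ifs <;> omega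

/-- In a simply connected region, every edge function that has no curl on the squares of the region
is on the edges of the region the gradient of a potential. -/
theorem exists_region_potential {R : Region} (hR : SimplyConnected R.toSet) (a b : ℤ → ℤ → ℤ)
    (h : ∀ x y, (x, y) ∈ R → a x y + b (x + 1) y - a x (y + 1) - b x y = 0) :
    ∃ H : ℤ → ℤ → ℤ, (∀ x y, HEdge R x y → H (x + 1) y - H x y = a x y) ∧
      ∀ x y, VEdge R x y → H x (y + 1) - H x y = b x y := by
  classical
  -- Truncation to the edges of `R` leaves the curl `k` zero on `R` and makes its support finite, so
  -- that finitely many vortices can cancel it.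
  let a' : ℤ → ℤ → ℤ := fun x y ↦ if HEdge R x y then a x y else 0
  let b' : ℤ → ℤ → ℤ := fun x y ↦ if VEdge R x y then b x y else 0
  let k : Square → ℤ := fun s ↦
    a' s.1 s.2 + b' (s.1 + 1) s.2 - a' s.1 (s.2 + 1) - b' s.1 s.2
  have hk : ∀ s ∈ R, k s = 0 := by
    rintro ⟨x, y⟩ hs
    rw [← h x y hs]
    simp only [k, a', b']
    rw [if_pos (show HEdge R x y from .inl hs), if_pos (show VEdge R x y from .inl hs),
      if_pos (show HEdge R x (y + 1) from .inr (by simpa using hs)),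
      if_pos (show VEdge R (x + 1) y from .inr (by simpa using hs))]
  have hfin : (Function.support k).Finite := by
    refine (R ∪ (R.image (fun s ↦ (s.1, s.2 + 1)) ∪ R.image (fun s ↦ (s.1, s.2 - 1)) ∪
      R.image (fun s ↦ (s.1 + 1, s.2)) ∪ R.image (fun s ↦ (s.1 - 1, s.2)))).finite_toSet.subset ?_
    rintro ⟨x, y⟩ hs
    by_contra hcon
    simp only [Finset.coe_union, Finset.coe_image, Set.mem_union, Finset.mem_coe, Set.mem_image,
      Prod.mk.injEq, Prod.exists, not_or, not_exists, not_and] at hcon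
    obtain ⟨h0, ⟨⟨h1, h2⟩, h3⟩, h4⟩ := hcon
    apply hs
    have e1 : ¬ HEdge R x y := by
      rintro (h | h)
      · exact h0 h
      · exact h1 _ _ h rfl (by ring)
    have e2 : ¬ HEdge R x (y + 1) := by
      rintro (h | h)
      · exact h2 _ _ h rfl (by ring)
      · exact h0 (by simpa using h)
    have e3 : ¬ VEdge R x y := by
      rintro (h | h)
      · exact h0 h
      · exact h3 _ _ h (by ring) rfl
    have e4 : ¬ VEdge R (x + 1) y := by
      rintro (h | h)
      · exact h4 _ _ h (by ring) rfl
      · exact h0 (by simpa using h)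
    simp [k, a', b', e1, e2, e3, e4]
  have hC : ∀ c : hfin.toFinset, c.1 ∉ R := fun c hc ↦
    (hfin.mem_toFinset.1 c.2) (hk _ hc)
  choose u v hu hv huv using fun c : hfin.toFinset ↦ exists_vortex hR (hC c)
  obtain ⟨H, hH1, hH2⟩ := exists_grid_potential
    (fun x y ↦ a' x y - ∑ c, k c.1 * u c x y) (fun x y ↦ b' x y - ∑ c, k c.1 * v c x y) (by
      intro x y
      have e : ∑ c : hfin.toFinset, k c.1 *
          (u c x y + v c (x + 1) y - u c x (y + 1) - v c x y) = k (x, y) := by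
        simp only [huv]
        rw [Finset.sum_coe_sort hfin.toFinset (fun c ↦ k c * if (x, y) = c then 1 else 0)]
        simp only [mul_ite, mul_one, mul_zero, Finset.sum_ite_eq, hfin.mem_toFinset]
        split_ifs with hxy
        · rfl
        · exact (Function.notMem_support.1 hxy).symm
      simp only [mul_sub, mul_add, Finset.sum_sub_distrib, Finset.sum_add_distrib] at e
      have e' : k (x, y) = a' x y + b' (x + 1) y - a' x (y + 1) - b' x y := rfl
      linarith)
  refine ⟨H, fun x y hxy ↦ ?_, fun x y hxy ↦ ?_⟩
  · rw [hH1, Finset.sum_eq_zero fun c _ ↦ by rw [hu c x y hxy, mul_zero]]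
    simp [a', hxy]
  · rw [hH2, Finset.sum_eq_zero fun c _ ↦ by rw [hv c x y hxy, mul_zero]]
    simp [b', hxy]

/-! ### Functions that vary only across the interior -/

/-- A function on the grid points that is constant along all edges which are not common to two
squares of the region. -/
structure ConstantOffInterior (R : Region) (d : ℤ → ℤ → ℤ) : Prop where
  horizontal : ∀ x y, ¬((x, y) ∈ R ∧ (x, y - 1) ∈ R) → d (x + 1) y = d x y
  vertical : ∀ x y, ¬((x, y) ∈ R ∧ (x - 1, y) ∈ R) → d x (y + 1) = d x y

theorem eq_of_forall_add_one_eq {f : ℤ → ℤ} (h : ∀ x, f (x + 1) = f x) (x y : ℤ) : f x = f y := by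
  have : ∀ x, f x = f 0 := fun x ↦ by
    induction x using Int.induction_on with
    | zero => rfl
    | succ i hi => rw [h, hi]
    | pred i hi => rw [← h, sub_add_cancel, hi]
  rw [this x, this y]

/-- Grid lines that miss a box around `R` carry a constant value, and any point outside the box is
joined to a far corner by such lines. -/
theorem ConstantOffInterior.exists_finite {R : Region} {d : ℤ → ℤ → ℤ}
    (hd : ConstantOffInterior R d) : ∃ K, {v : ℤ × ℤ | d v.1 v.2 ≠ K}.Finite := by
  -- A crude bound: the sum dominates each coordinate of each square of `R`.
  set N : ℤ := ∑ c ∈ R, (|c.1| + |c.2|) with hN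
  have hb : ∀ x y, (N < |x| ∨ N < |y|) → (x, y) ∉ R := by
    intro x y h hm
    have := Finset.single_le_sum (f := fun c : Square ↦ |c.1| + |c.2|)
      (fun c _ ↦ add_nonneg (abs_nonneg _) (abs_nonneg _)) hm
    simp only [← hN] at this
    have := abs_nonneg x
    have := abs_nonneg y
    omega
  have row : ∀ y, N < |y| → ∀ x x', d x y = d x' y := fun y hy x x' ↦
    eq_of_forall_add_one_eq (f := fun x ↦ d x y)
      (fun x ↦ hd.horizontal x y fun h ↦ hb x y (.inr hy) h.1) x x'
  have col : ∀ x, N < |x| → ∀ y y', d x y = d x y' := fun x hx y y' ↦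
    eq_of_forall_add_one_eq (f := d x)
      (fun y ↦ hd.vertical x y fun h ↦ hb x y (.inl hx) h.1) y y'
  have hN1 : N < |N + 1| := lt_of_lt_of_le (lt_add_one N) (le_abs_self _)
  refine ⟨d (N + 1) (N + 1), ((Finset.Icc (-N) N ×ˢ Finset.Icc (-N) N).finite_toSet).subset ?_⟩
  rintro ⟨x, y⟩ hxy
  by_contra hcon
  simp only [Finset.coe_product, Finset.coe_Icc, Set.mem_prod, ← abs_le, Set.mem_Icc,
    not_and_or, not_le] at hcon
  apply hxy
  rcases hcon with h | h
  · exact (col x h y (N + 1)).trans (row _ hN1 _ _)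
  · exact (row y h x (N + 1)).trans (col _ hN1 _ _)

/-- Summation by parts: pairing `d` with the curl of the vortex at `(x, y)` gives `d x y`, and the
same sum telescopes to 0 by finite support. -/
theorem ConstantOffInterior.eq_zero {R : Region} (hR : SimplyConnected R.toSet) {d : ℤ → ℤ → ℤ}
    (hd : ConstantOffInterior R d) (hfin : {v : ℤ × ℤ | d v.1 v.2 ≠ 0}.Finite) {x y : ℤ}
    (hxy : (x, y) ∉ R) : d x y = 0 := by
  obtain ⟨a, b, ha, hb, hab⟩ := exists_vortex hR hxy
  let A : ℤ × ℤ → ℤ := fun v ↦ d v.1 v.2 * a v.1 v.2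
  let B : ℤ × ℤ → ℤ := fun v ↦ d v.1 v.2 * b v.1 v.2
  have hA : (Function.support A).Finite := hfin.subset fun v hv ↦ left_ne_zero_of_mul hv
  have hB : (Function.support B).Finite := hfin.subset fun v hv ↦ left_ne_zero_of_mul hv
  let e : ℤ × ℤ ≃ ℤ × ℤ := Equiv.prodCongr (Equiv.refl _) (Equiv.addRight 1)
  let f : ℤ × ℤ ≃ ℤ × ℤ := Equiv.prodCongr (Equiv.addRight 1) (Equiv.refl _)
  have hAe : (Function.support (A ∘ e)).Finite := by
    rw [Function.support_comp_eq_preimage]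
    exact hA.preimage e.injective.injOn
  have hBf : (Function.support (B ∘ f)).Finite := by
    rw [Function.support_comp_eq_preimage]
    exact hB.preimage f.injective.injOn
  -- On a square of `R` the vortex vanishes on all four edges. On any other square `d` has one value
  -- at the corners involved and factors out of the curl.
  have key : ∀ v : ℤ × ℤ, (A v - (A ∘ e) v) + ((B ∘ f) v - B v) =
      if v = (x, y) then d x y else 0 := by
    rintro ⟨p, q⟩
    simp only [A, B, e, f, Function.comp, Equiv.prodCongr_apply, Prod.map, Equiv.refl_apply,
      Equiv.coe_addRight]
    by_cases hm : (p, q) ∈ R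
    · rw [ha p q (.inl hm), hb p q (.inl hm), ha p (q + 1) (.inr (by simpa using hm)),
        hb (p + 1) q (.inr (by simpa using hm)), if_neg (fun h : (p, q) = (x, y) ↦ hxy (h ▸ hm))]
      ring
    · have e1 := hd.horizontal p q (fun h ↦ hm h.1)
      have e2 := hd.vertical p q (fun h ↦ hm h.1)
      have := hab p q
      rw [e1, e2]
      split_ifs with h
      · obtain ⟨rfl, rfl⟩ := Prod.mk.inj h
        rw [if_pos rfl] at this
        linear_combination d p q * this
      · rw [if_neg h] at this
        linear_combination d p q * this
  have hAs : ∑ᶠ v, (A ∘ e) v = ∑ᶠ v, A v := finsum_comp_equiv e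
  have hBs : ∑ᶠ v, (B ∘ f) v = ∑ᶠ v, B v := finsum_comp_equiv f
  have hsum := finsum_congr key
  rw [finsum_add_distrib ((hA.union hAe).subset (Function.support_sub _ _))
    ((hBf.union hB).subset (Function.support_sub _ _)), finsum_sub_distrib hA hAe,
    finsum_sub_distrib hBf hB, hAs, hBs,
    finsum_eq_single _ (x, y) (fun v hv ↦ if_neg hv)] at hsum
  simpa using hsum.symm

/-! ### Dominoes and tilings in terms of crossed edges -/

/-- The vertical domino across the horizontal edge from `(x, y)` to `(x + 1, y)`. -/
def vDomino (x y : ℤ) : Finset Square := {(x, y - 1), (x, y)}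

/-- The horizontal domino across the vertical edge from `(x, y)` to `(x, y + 1)`. -/
def hDomino (x y : ℤ) : Finset Square := {(x - 1, y), (x, y)}

theorem mem_vDomino {x y p q : ℤ} : (p, q) ∈ vDomino x y ↔ x = p ∧ (y = q ∨ y = q + 1) := by
  simp only [vDomino, Finset.mem_insert, Finset.mem_singleton, Prod.mk.injEq]
  omega

theorem mem_hDomino {x y p q : ℤ} : (p, q) ∈ hDomino x y ↔ (x = p ∨ x = p + 1) ∧ y = q := by
  simp only [hDomino, Finset.mem_insert, Finset.mem_singleton, Prod.mk.injEq]
  omega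

theorem vDomino_inj {x y p q : ℤ} : vDomino x y = vDomino p q ↔ x = p ∧ y = q := by
  refine ⟨fun h ↦ ?_, by rintro ⟨rfl, rfl⟩; rfl⟩
  have h1 : (x, y) ∈ vDomino p q := h ▸ mem_vDomino.2 ⟨rfl, .inl rfl⟩
  have h2 : (x, y - 1) ∈ vDomino p q := h ▸ mem_vDomino.2 ⟨rfl, .inr (by ring)⟩
  rw [mem_vDomino] at h1 h2
  omega

theorem hDomino_inj {x y p q : ℤ} : hDomino x y = hDomino p q ↔ x = p ∧ y = q := by
  refine ⟨fun h ↦ ?_, by rintro ⟨rfl, rfl⟩; rfl⟩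
  have h1 : (x, y) ∈ hDomino p q := h ▸ mem_hDomino.2 ⟨.inl rfl, rfl⟩
  have h2 : (x - 1, y) ∈ hDomino p q := h ▸ mem_hDomino.2 ⟨.inr (by ring), rfl⟩
  rw [mem_hDomino] at h1 h2
  omega

theorem vDomino_ne_hDomino {x y p q : ℤ} : vDomino x y ≠ hDomino p q := by
  intro h
  have h1 : (x, y) ∈ hDomino p q := h ▸ mem_vDomino.2 ⟨rfl, .inl rfl⟩
  have h2 : (x, y - 1) ∈ hDomino p q := h ▸ mem_vDomino.2 ⟨rfl, .inr (by ring)⟩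
  rw [mem_hDomino] at h1 h2
  omega

theorem isDomino_vDomino (x y : ℤ) : IsDomino (vDomino x y) :=
  ⟨(x, y - 1), (x, y), ⟨by simp, ((x, y), (x + 1, y)), by simp [Square.faces]⟩, rfl⟩

theorem isDomino_hDomino (x y : ℤ) : IsDomino (hDomino x y) :=
  ⟨(x - 1, y), (x, y), ⟨by simp, ((x, y), (x, y + 1)), by simp [Square.faces]⟩, rfl⟩

theorem IsDomino.eq_or {d : Finset Square} (h : IsDomino d) :
    ∃ x y, d = vDomino x y ∨ d = hDomino x y := by
  obtain ⟨⟨a, b⟩, ⟨p, q⟩, ⟨hne, f, hf⟩, rfl⟩ := h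
  have : (p = a ∧ q = b + 1) ∨ (p = a ∧ b = q + 1) ∨ (p = a + 1 ∧ q = b) ∨ (a = p + 1 ∧ q = b) := by
    obtain ⟨⟨f1, f2⟩, f3, f4⟩ := f
    simp only [Square.faces, Finset.mem_inter, Finset.mem_insert, Finset.mem_singleton,
      Prod.mk.injEq] at hf
    rw [ne_eq, Prod.mk.injEq] at hne
    omega
  rcases this with ⟨rfl, rfl⟩ | ⟨rfl, rfl⟩ | ⟨rfl, rfl⟩ | ⟨rfl, rfl⟩
  · exact ⟨p, b + 1, .inl (by simp [vDomino])⟩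
  · exact ⟨p, q + 1, .inl (by simp [vDomino, Finset.pair_comm])⟩
  · exact ⟨a + 1, q, .inr (by simp [hDomino])⟩
  · exact ⟨p + 1, q, .inr (by simp [hDomino, Finset.pair_comm])⟩

/-- The number (zero or one) of vertical dominoes of `T` across a horizontal edge. -/
def vCount (T : Finset (Finset Square)) (x y : ℤ) : ℤ := if vDomino x y ∈ T then 1 else 0

/-- The number (zero or one) of horizontal dominoes of `T` across a vertical edge. -/
def hCount (T : Finset (Finset Square)) (x y : ℤ) : ℤ := if hDomino x y ∈ T then 1 else 0

variable {R : Region} {T : Finset (Finset Square)}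

theorem IsTiling.subset (h : IsTiling R T) {d : Finset Square} (hd : d ∈ T) : d ⊆ R := (h.1 d hd).2

theorem IsTiling.eq_of_mem (h : IsTiling R T) {d d' : Finset Square} (hd : d ∈ T) (hd' : d' ∈ T)
    {c : Square} (hc : c ∈ d) (hc' : c ∈ d') : d = d' :=
  (h.2 c (h.subset hd hc)).unique ⟨hd, hc⟩ ⟨hd', hc'⟩

theorem IsTiling.vCount_eq_zero (h : IsTiling R T) {x y : ℤ} (hxy : ¬((x, y) ∈ R ∧ (x, y - 1) ∈ R)) :
    vCount T x y = 0 :=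
  if_neg fun hm ↦ hxy ⟨h.subset hm (by simp [vDomino]), h.subset hm (by simp [vDomino])⟩

theorem IsTiling.hCount_eq_zero (h : IsTiling R T) {x y : ℤ} (hxy : ¬((x, y) ∈ R ∧ (x - 1, y) ∈ R)) :
    hCount T x y = 0 :=
  if_neg fun hm ↦ hxy ⟨h.subset hm (by simp [hDomino]), h.subset hm (by simp [hDomino])⟩

/-- Each square of the region is covered exactly once. -/
theorem IsTiling.sum_count (h : IsTiling R T) (x y : ℤ) :
    vCount T x y + vCount T x (y + 1) + hCount T x y + hCount T (x + 1) y =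
      if (x, y) ∈ R then 1 else 0 := by
  split_ifs with hm
  · obtain ⟨d, ⟨hd, hc⟩, -⟩ := h.2 _ hm
    have m1 : (x, y) ∈ vDomino x y := mem_vDomino.2 ⟨rfl, .inl rfl⟩
    have m2 : (x, y) ∈ vDomino x (y + 1) := mem_vDomino.2 ⟨rfl, .inr rfl⟩
    have m3 : (x, y) ∈ hDomino x y := mem_hDomino.2 ⟨.inl rfl, rfl⟩
    have m4 : (x, y) ∈ hDomino (x + 1) y := mem_hDomino.2 ⟨.inr rfl, rfl⟩
    -- By uniqueness, each of the four candidate dominoes belongs to `T` exactly when it is `d`.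
    have key : ∀ d', (x, y) ∈ d' → (d' ∈ T ↔ d' = d) := fun d' hd' ↦
      ⟨fun h' ↦ h.eq_of_mem h' hd hd' hc, fun h' ↦ h' ▸ hd⟩
    simp only [vCount, hCount, key _ m1, key _ m2, key _ m3, key _ m4]
    obtain ⟨p, q, rfl | rfl⟩ := (h.1 d hd).1.eq_or
    · rw [mem_vDomino] at hc
      simp only [vDomino_inj, vDomino_ne_hDomino.symm, if_false]
      split_ifs <;> omega
    · rw [mem_hDomino] at hc
      simp only [hDomino_inj, vDomino_ne_hDomino, if_false]
      split_ifs <;> omega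
  · rw [h.vCount_eq_zero (fun h ↦ hm h.1), h.hCount_eq_zero (fun h ↦ hm h.1),
      h.vCount_eq_zero (fun h ↦ hm (by simpa using h.2)),
      h.hCount_eq_zero (fun h ↦ hm (by simpa using h.2))]
    rfl

theorem IsTiling.eq_of_count_eq {T' : Finset (Finset Square)} (h : IsTiling R T)
    (h' : IsTiling R T') (hv : ∀ x y, vCount T x y = vCount T' x y)
    (hh : ∀ x y, hCount T x y = hCount T' x y) : T = T' := by
  have hv' : ∀ x y, vDomino x y ∈ T ↔ vDomino x y ∈ T' := fun x y ↦ by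
    have := hv x y
    simp only [vCount] at this
    split_ifs at this <;> simp_all
  have hh' : ∀ x y, hDomino x y ∈ T ↔ hDomino x y ∈ T' := fun x y ↦ by
    have := hh x y
    simp only [hCount] at this
    split_ifs at this <;> simp_all
  ext d
  constructor <;> intro hd
  · obtain ⟨x, y, rfl | rfl⟩ := (h.1 d hd).1.eq_or
    exacts [(hv' x y).1 hd, (hh' x y).1 hd]
  · obtain ⟨x, y, rfl | rfl⟩ := (h'.1 d hd).1.eq_or
    exacts [(hv' x y).2 hd, (hh' x y).2 hd]

/-! ### Flips as replacements in a tiling -/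

/-- Replacing some dominoes of a tiling by dominoes that cover the same squares once each gives a
tiling. -/
theorem IsTiling.replace (h : IsTiling R T) {M₁ M₂ : Finset (Finset Square)} (h₁ : M₁ ⊆ T)
    (h₂ : ∀ d ∈ M₂, IsDomino d) (hcov : ∀ c, (∃ d ∈ M₁, c ∈ d) ↔ ∃ d ∈ M₂, c ∈ d)
    (hdisj : ∀ d ∈ M₂, ∀ d' ∈ M₂, ∀ c ∈ d, c ∈ d' → d = d') :
    (∀ d ∈ M₁ ∪ M₂, d ∈ dominoes R) ∧ IsTiling R ((T \ M₁) ∪ M₂) := by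
  have hdom : ∀ d ∈ M₂, d ∈ dominoes R := fun d hd ↦ ⟨h₂ d hd, fun c hc ↦ by
    obtain ⟨d', hd', hc'⟩ := (hcov c).2 ⟨d, hd, hc⟩
    exact h.subset (h₁ hd') hc'⟩
  refine ⟨fun d hd ↦ (Finset.mem_union.1 hd).elim (fun hd ↦ h.1 d (h₁ hd)) (hdom d),
    fun d hd ↦ (Finset.mem_union.1 hd).elim (fun hd ↦ h.1 d (Finset.mem_sdiff.1 hd).1) (hdom d),
    fun c hc ↦ ?_⟩
  by_cases hM : ∃ d ∈ M₂, c ∈ d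
  · obtain ⟨d₁, hd₁, hc₁⟩ := (hcov c).2 hM
    obtain ⟨d, hd, hcd⟩ := hM
    refine ⟨d, ⟨Finset.mem_union_right _ hd, hcd⟩, ?_⟩
    rintro d' ⟨hd', hcd'⟩
    rcases Finset.mem_union.1 hd' with hd' | hd'
    · obtain ⟨hT, hn⟩ := Finset.mem_sdiff.1 hd'
      exact absurd (h.eq_of_mem hT (h₁ hd₁) hcd' hc₁ ▸ hd₁) hn
    · exact hdisj d' hd' d hd c hcd' hcd
  · obtain ⟨d, ⟨hd, hcd⟩, hu⟩ := h.2 c hc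
    refine ⟨d, ⟨Finset.mem_union_left _ (Finset.mem_sdiff.2 ⟨hd, fun hn ↦
      hM ((hcov c).1 ⟨d, hn, hcd⟩)⟩), hcd⟩, ?_⟩
    rintro d' ⟨hd', hcd'⟩
    rcases Finset.mem_union.1 hd' with hd' | hd'
    · exact hu d' ⟨(Finset.mem_sdiff.1 hd').1, hcd'⟩
    · exact absurd ⟨d', hd', hcd'⟩ hM

/-- A flip is indexed by the grid point `(x, y)` at the centre of its block, where the height will
change. -/
theorem verticalPair_eq (x y : ℤ) :
    verticalPair (x - 1, y - 1) = {vDomino (x - 1) y, vDomino x y} := by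
  simp [verticalPair, vDomino]

theorem horizontalPair_eq (x y : ℤ) :
    horizontalPair (x - 1, y - 1) = {hDomino x (y - 1), hDomino x y} := by
  simp [horizontalPair, hDomino]

/-- Two adjacent vertical dominoes can be flipped. -/
theorem IsTiling.flip_vertical (h : IsTiling R T) {x y : ℤ} (h1 : vDomino (x - 1) y ∈ T)
    (h2 : vDomino x y ∈ T) :
    FlipStep R T ((T \ {vDomino (x - 1) y, vDomino x y}) ∪ {hDomino x (y - 1), hDomino x y}) := by
  have h₁ : {vDomino (x - 1) y, vDomino x y} ⊆ T := by
    simp [Finset.insert_subset_iff, h1, h2]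
  obtain ⟨hd, ht⟩ := h.replace (M₂ := {hDomino x (y - 1), hDomino x y}) h₁
    (by simp [isDomino_hDomino])
    (by
      rintro ⟨p, q⟩
      simp only [Finset.mem_insert, Finset.mem_singleton, exists_eq_or_imp, exists_eq_left,
        mem_vDomino, mem_hDomino]
      omega)
    (by
      simp only [Finset.mem_insert, Finset.mem_singleton]
      rintro d (rfl | rfl) d' (rfl | rfl) ⟨p, q⟩ <;> simp only [mem_hDomino] <;> intros <;>
        first | rfl | trivial | omega)
  exact ⟨ht, (_, _), ⟨hd, (x - 1, y - 1), .inr (by rw [verticalPair_eq, horizontalPair_eq])⟩,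
    h₁, rfl⟩

/-- Two adjacent horizontal dominoes can be flipped. -/
theorem IsTiling.flip_horizontal (h : IsTiling R T) {x y : ℤ} (h1 : hDomino x (y - 1) ∈ T)
    (h2 : hDomino x y ∈ T) :
    FlipStep R T ((T \ {hDomino x (y - 1), hDomino x y}) ∪ {vDomino (x - 1) y, vDomino x y}) := by
  have h₁ : {hDomino x (y - 1), hDomino x y} ⊆ T := by
    simp [Finset.insert_subset_iff, h1, h2]
  obtain ⟨hd, ht⟩ := h.replace (M₂ := {vDomino (x - 1) y, vDomino x y}) h₁
    (by simp [isDomino_vDomino])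
    (by
      rintro ⟨p, q⟩
      simp only [Finset.mem_insert, Finset.mem_singleton, exists_eq_or_imp, exists_eq_left,
        mem_vDomino, mem_hDomino]
      omega)
    (by
      simp only [Finset.mem_insert, Finset.mem_singleton]
      rintro d (rfl | rfl) d' (rfl | rfl) ⟨p, q⟩ <;> simp only [mem_vDomino] <;> intros <;>
        first | rfl | trivial | omega)
  exact ⟨ht, (_, _), ⟨hd, (x - 1, y - 1), .inl (by rw [verticalPair_eq, horizontalPair_eq])⟩,
    h₁, rfl⟩

/-! ### Height functions and height differences -/

/-- The checkerboard colouring of the grid. -/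
def checker (x y : ℤ) : ℤ := if Even (x + y) then 1 else -1

theorem checker_add_left (x y : ℤ) : checker (x + 1) y = -checker x y := by
  simp only [checker, show x + 1 + y = x + y + 1 by ring, Int.even_add_one]
  split_ifs <;> simp_all

theorem checker_add_right (x y : ℤ) : checker x (y + 1) = -checker x y := by
  simp only [checker, ← add_assoc, Int.even_add_one]
  split_ifs <;> simp_all

theorem checker_sub_left (x y : ℤ) : checker (x - 1) y = -checker x y := by
  have := checker_add_left (x - 1) y
  rw [sub_add_cancel] at this
  rw [this, neg_neg]

theorem checker_sub_right (x y : ℤ) : checker x (y - 1) = -checker x y := by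
  have := checker_add_right x (y - 1)
  rw [sub_add_cancel] at this
  rw [this, neg_neg]

theorem checker_eq (x y : ℤ) : checker x y = 1 ∨ checker x y = -1 := ite_eq_or_eq _ _ _

/-- A tiling of a simply connected region has a height function. -/
theorem IsTiling.exists_height (hR : SimplyConnected R.toSet) (h : IsTiling R T) :
    ∃ H : ℤ → ℤ → ℤ,
      (∀ x y, HEdge R x y → H (x + 1) y - H x y = checker x y * (1 - 4 * vCount T x y)) ∧
      ∀ x y, VEdge R x y → H x (y + 1) - H x y = -checker x y * (1 - 4 * hCount T x y) := by
  -- The curl on a square is `checker x y` times four minus four times the number of dominoes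
  -- covering it.
  refine exists_region_potential hR _ _ fun x y hxy ↦ ?_
  have := h.sum_count x y
  rw [if_pos hxy] at this
  rw [checker_add_left, checker_add_right]
  linear_combination -4 * checker x y * this

/-- `d` is a quarter of the difference of the height functions of the tilings `T₁` and `T₂`. -/
structure IsHeightDifference (R : Region) (T₁ T₂ : Finset (Finset Square)) (d : ℤ → ℤ → ℤ) :
    Prop where
  horizontal : ∀ x y, d (x + 1) y - d x y = -checker x y * (vCount T₁ x y - vCount T₂ x y)
  vertical : ∀ x y, d x (y + 1) - d x y = checker x y * (hCount T₁ x y - hCount T₂ x y)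
  interior : ∀ x y, d x y ≠ 0 → (x, y) ∈ R ∧ (x - 1, y) ∈ R ∧ (x, y - 1) ∈ R

/-- Two tilings of a simply connected region have a height difference. -/
theorem exists_isHeightDifference (hR : SimplyConnected R.toSet) {T₁ T₂ : Finset (Finset Square)}
    (h₁ : IsTiling R T₁) (h₂ : IsTiling R T₂) : ∃ d, IsHeightDifference R T₁ T₂ d := by
  -- The constants 1 cancel in the difference, so it is curl-free on the whole grid: both tilings
  -- cover every square equally often, zero times outside `R`.
  obtain ⟨D, hD1, hD2⟩ := exists_grid_potential
    (fun x y ↦ -checker x y * (vCount T₁ x y - vCount T₂ x y))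
    (fun x y ↦ checker x y * (hCount T₁ x y - hCount T₂ x y)) (fun x y ↦ by
      have e1 := h₁.sum_count x y
      have e2 := h₂.sum_count x y
      rw [checker_add_left, checker_add_right]
      linear_combination checker x y * (e2 - e1))
  have hD : ConstantOffInterior R D := by
    refine ⟨fun x y h ↦ ?_, fun x y h ↦ ?_⟩
    · rw [← sub_eq_zero, hD1, h₁.vCount_eq_zero h, h₂.vCount_eq_zero h]; simp
    · rw [← sub_eq_zero, hD2, h₁.hCount_eq_zero h, h₂.hCount_eq_zero h]; simp
  obtain ⟨K, hK⟩ := hD.exists_finite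
  have hd : ConstantOffInterior R fun x y ↦ D x y - K :=
    ⟨fun x y h ↦ by rw [hD.horizontal x y h], fun x y h ↦ by rw [hD.vertical x y h]⟩
  have hz : ∀ x y, (x, y) ∉ R → D x y - K = 0 := fun x y ↦
    hd.eq_zero hR (by simpa only [ne_eq, sub_eq_zero] using hK)
  refine ⟨fun x y ↦ D x y - K, fun x y ↦ by simp only [sub_sub_sub_cancel_right, hD1],
    fun x y ↦ by simp only [sub_sub_sub_cancel_right, hD2], fun x y hne ↦ ⟨?_, ?_, ?_⟩⟩
  · by_contra h
    exact hne (hz x y h)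
  -- `(x, y)` is the right end of the bottom edge of the square `(x - 1, y)`; if that square is
  -- outside `R`, the zero at its lower left corner carries over. The next case uses the left edge
  -- of `(x, y - 1)`.
  · by_contra h
    have := hD.horizontal (x - 1) y (fun h' ↦ h h'.1)
    rw [sub_add_cancel] at this
    exact hne (this ▸ hz _ _ h)
  · by_contra h
    have := hD.vertical x (y - 1) (fun h' ↦ h h'.1)
    rw [sub_add_cancel] at this
    exact hne (this ▸ hz _ _ h)

variable {T₁ T₂ : Finset (Finset Square)}

/-- The conditions on the indices say that both dominoes contain the square `(x, q)`. -/
theorem IsTiling.not_mem_of_vDomino_mem (h : IsTiling R T) {x y p q : ℤ} (hv : vDomino x y ∈ T)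
    (hx : x = p ∨ p = x + 1) (hy : y = q ∨ y = q + 1) : hDomino p q ∉ T := fun hh ↦
  vDomino_ne_hDomino (h.eq_of_mem hv hh (c := (x, q)) (mem_vDomino.2 ⟨rfl, hy⟩)
    (mem_hDomino.2 ⟨by omega, rfl⟩))

theorem IsTiling.not_mem_of_hDomino_mem (h : IsTiling R T) {x y p q : ℤ} (hh : hDomino p q ∈ T)
    (hx : x = p ∨ p = x + 1) (hy : y = q ∨ y = q + 1) : vDomino x y ∉ T := fun hv ↦
  h.not_mem_of_vDomino_mem hv hx hy hh

/-! ### The effect of flips on the height difference -/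

/-- Flipping two vertical dominoes around `(x, y)` changes the height difference there only. -/
theorem IsHeightDifference.flip_vertical {d : ℤ → ℤ → ℤ} (hd : IsHeightDifference R T₁ T₂ d)
    (h : IsTiling R T₁) {x y : ℤ} (h1 : vDomino (x - 1) y ∈ T₁) (h2 : vDomino x y ∈ T₁)
    (hxy : d x y ≠ 0) :
    IsHeightDifference R ((T₁ \ {vDomino (x - 1) y, vDomino x y}) ∪
        {hDomino x (y - 1), hDomino x y}) T₂
      fun a b ↦ d a b - if a = x ∧ b = y then checker x y else 0 := by
  set T' := (T₁ \ {vDomino (x - 1) y, vDomino x y}) ∪ {hDomino x (y - 1), hDomino x y} with hT'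
  have hv : ∀ a b, vCount T' a b =
      vCount T₁ a b - if (a = x ∨ a = x - 1) ∧ b = y then 1 else 0 := by
    intro a b
    simp only [vCount, hT', Finset.mem_union, Finset.mem_sdiff, Finset.mem_insert,
      Finset.mem_singleton, vDomino_ne_hDomino, vDomino_inj, or_false]
    by_cases hab : (a = x ∨ a = x - 1) ∧ b = y
    · obtain ⟨rfl | rfl, rfl⟩ := hab <;> simp [h1, h2]
    · rw [if_neg hab, sub_zero]
      exact if_congr (and_iff_left (by omega)) rfl rfl
  have hh : ∀ a b, hCount T' a b =
      hCount T₁ a b + if a = x ∧ (b = y ∨ b = y - 1) then 1 else 0 := by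
    intro a b
    simp only [hCount, hT', Finset.mem_union, Finset.mem_sdiff, Finset.mem_insert,
      Finset.mem_singleton, vDomino_ne_hDomino.symm, hDomino_inj, or_false, not_false_eq_true,
      and_true]
    by_cases hab : a = x ∧ (b = y ∨ b = y - 1)
    · have : hDomino a b ∉ T₁ := h.not_mem_of_vDomino_mem h2 (by omega) (by omega)
      rw [if_pos (by omega), if_neg this, if_pos hab, zero_add]
    · rw [if_neg hab, add_zero]
      exact if_congr (or_iff_left (by omega)) rfl rfl
  refine ⟨fun a b ↦ ?_, fun a b ↦ ?_, fun a b hne ↦ ?_⟩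
  -- The point mass at `(x, y)` changes along the two adjacent horizontal edges with opposite signs,
  -- as `checker` does, which matches the two removed dominoes.
  · have e : ((if a = x ∧ b = y then checker x y else 0) -
        if a + 1 = x ∧ b = y then checker x y else 0) =
        checker a b * if (a = x ∨ a = x - 1) ∧ b = y then 1 else 0 := by
      by_cases hab : (a = x ∨ a = x - 1) ∧ b = y
      · obtain ⟨rfl | rfl, rfl⟩ := hab <;> simp [checker_sub_left]
      · rw [if_neg hab, if_neg (by omega), if_neg (by omega)]; simp
    rw [hv]
    linear_combination hd.horizontal a b + e
  · have e : ((if a = x ∧ b = y then checker x y else 0) -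
        if a = x ∧ b + 1 = y then checker x y else 0) =
        checker a b * if a = x ∧ (b = y ∨ b = y - 1) then 1 else 0 := by
      by_cases hab : a = x ∧ (b = y ∨ b = y - 1)
      · obtain ⟨rfl, rfl | rfl⟩ := hab <;> simp [checker_sub_right]
      · rw [if_neg hab, if_neg (by omega), if_neg (by omega)]; simp
    rw [hh]
    linear_combination hd.vertical a b + e
  · by_cases hab : a = x ∧ b = y
    · obtain ⟨rfl, rfl⟩ := hab
      exact hd.interior _ _ hxy
    · exact hd.interior a b (by simpa [hab] using hne)

/-- Flipping two horizontal dominoes around `(x, y)` changes the height difference there only. -/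
theorem IsHeightDifference.flip_horizontal {d : ℤ → ℤ → ℤ} (hd : IsHeightDifference R T₁ T₂ d)
    (h : IsTiling R T₁) {x y : ℤ} (h1 : hDomino x (y - 1) ∈ T₁) (h2 : hDomino x y ∈ T₁)
    (hxy : d x y ≠ 0) :
    IsHeightDifference R ((T₁ \ {hDomino x (y - 1), hDomino x y}) ∪
        {vDomino (x - 1) y, vDomino x y}) T₂
      fun a b ↦ d a b - if a = x ∧ b = y then -checker x y else 0 := by
  set T' := (T₁ \ {hDomino x (y - 1), hDomino x y}) ∪ {vDomino (x - 1) y, vDomino x y} with hT'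
  have hv : ∀ a b, vCount T' a b =
      vCount T₁ a b + if (a = x ∨ a = x - 1) ∧ b = y then 1 else 0 := by
    intro a b
    simp only [vCount, hT', Finset.mem_union, Finset.mem_sdiff, Finset.mem_insert,
      Finset.mem_singleton, vDomino_ne_hDomino, vDomino_inj, or_false, not_false_eq_true,
      and_true]
    by_cases hab : (a = x ∨ a = x - 1) ∧ b = y
    · have : vDomino a b ∉ T₁ := h.not_mem_of_hDomino_mem h2 (by omega) (by omega)
      rw [if_pos (by omega), if_neg this, if_pos hab, zero_add]
    · rw [if_neg hab, add_zero]
      exact if_congr (or_iff_left (by omega)) rfl rfl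
  have hh : ∀ a b, hCount T' a b =
      hCount T₁ a b - if a = x ∧ (b = y ∨ b = y - 1) then 1 else 0 := by
    intro a b
    simp only [hCount, hT', Finset.mem_union, Finset.mem_sdiff, Finset.mem_insert,
      Finset.mem_singleton, vDomino_ne_hDomino.symm, hDomino_inj, or_false]
    by_cases hab : a = x ∧ (b = y ∨ b = y - 1)
    · obtain ⟨rfl, rfl | rfl⟩ := hab <;> simp [h1, h2]
    · rw [if_neg hab, sub_zero]
      exact if_congr (and_iff_left (by omega)) rfl rfl
  refine ⟨fun a b ↦ ?_, fun a b ↦ ?_, fun a b hne ↦ ?_⟩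
  · have e : ((if a = x ∧ b = y then -checker x y else 0) -
        if a + 1 = x ∧ b = y then -checker x y else 0) =
        -checker a b * if (a = x ∨ a = x - 1) ∧ b = y then 1 else 0 := by
      by_cases hab : (a = x ∨ a = x - 1) ∧ b = y
      · obtain ⟨rfl | rfl, rfl⟩ := hab <;> simp [checker_sub_left]
      · rw [if_neg hab, if_neg (by omega), if_neg (by omega)]; simp
    rw [hv]
    linear_combination hd.horizontal a b + e
  · have e : ((if a = x ∧ b = y then -checker x y else 0) -
        if a = x ∧ b + 1 = y then -checker x y else 0) =
        -checker a b * if a = x ∧ (b = y ∨ b = y - 1) then 1 else 0 := by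
      by_cases hab : a = x ∧ (b = y ∨ b = y - 1)
      · obtain ⟨rfl, rfl | rfl⟩ := hab <;> simp [checker_sub_right]
      · rw [if_neg hab, if_neg (by omega), if_neg (by omega)]; simp
    rw [hh]
    linear_combination hd.vertical a b + e
  · by_cases hab : a = x ∧ b = y
    · obtain ⟨rfl, rfl⟩ := hab
      exact hd.interior _ _ hxy
    · exact hd.interior a b (by simpa [hab] using hne)

theorem vCount_eq (T : Finset (Finset Square)) (x y : ℤ) :
    (vDomino x y ∈ T ∧ vCount T x y = 1) ∨ vCount T x y = 0 := by
  unfold vCount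
  split_ifs with h <;> simp [h]

theorem hCount_eq (T : Finset (Finset Square)) (x y : ℤ) :
    (hDomino x y ∈ T ∧ hCount T x y = 1) ∨ hCount T x y = 0 := by
  unfold hCount
  split_ifs with h <;> simp [h]

/-! ### Reducing the height difference -/

/-- If two tilings of a simply connected region are different at some point, in the direction given
by the sign `σ`, then a flip of the first one decreases the difference at such a point. -/
theorem IsHeightDifference.exists_flip (hR : SimplyConnected R.toSet) {d : ℤ → ℤ → ℤ}
    (hd : IsHeightDifference R T₁ T₂ d) (h : IsTiling R T₁) {σ : ℤ} (hσ : σ = 1 ∨ σ = -1)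
    (hpos : ∃ x y, 0 < σ * d x y) :
    ∃ x y, 0 < σ * d x y ∧ ∃ T, FlipStep R T₁ T ∧
      IsHeightDifference R T T₂ fun a b ↦ d a b - if a = x ∧ b = y then σ else 0 := by
  obtain ⟨H, hH1, hH2⟩ := h.exists_height hR
  have hmem : ∀ x y, 0 < σ * d x y → (x, y) ∈ R ∧ (x - 1, y) ∈ R ∧ (x, y - 1) ∈ R := fun x y hp ↦
    hd.interior x y (right_ne_zero_of_mul hp.ne')
  -- Among the points where `σ * d` is positive, one with maximal `σ * H` is taken; the squares
  -- given by `hmem` put its four edges into `R`.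
  obtain ⟨⟨x, y⟩, hv, hmax⟩ := (R.filter fun v ↦ 0 < σ * d v.1 v.2).exists_max_image
    (fun v ↦ σ * H v.1 v.2) (by
      obtain ⟨x, y, hp⟩ := hpos
      exact ⟨(x, y), Finset.mem_filter.2 ⟨(hmem x y hp).1, hp⟩⟩)
  have hp : 0 < σ * d x y := (Finset.mem_filter.1 hv).2
  have hle : ∀ a b, 0 < σ * d a b → σ * H a b ≤ σ * H x y := fun a b hab ↦
    hmax (a, b) (Finset.mem_filter.2 ⟨(hmem a b hab).1, hab⟩)
  obtain ⟨hm, hl, hb⟩ := hmem x y hp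
  have hr := hle (x + 1) y
  have hl' := hle (x - 1) y
  have hu := hle x (y + 1)
  have hb' := hle x (y - 1)
  have r1 := hH1 x y (.inl hm)
  have r2 := hd.horizontal x y
  have l1 := hH1 (x - 1) y (.inl hl)
  have l2 := hd.horizontal (x - 1) y
  have u1 := hH2 x y (.inl hm)
  have u2 := hd.vertical x y
  have b1 := hH2 x (y - 1) (.inl hb)
  have b2 := hd.vertical x (y - 1)
  rw [sub_add_cancel, checker_sub_left] at l1 l2
  rw [sub_add_cancel, checker_sub_right] at b1 b2
  have hxy : d x y ≠ 0 := right_ne_zero_of_mul hp.ne'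
  refine ⟨x, y, hp, ?_⟩
  -- If `checker x y = σ`, a horizontal edge at the point not crossed by `T₁` would lead to a
  -- neighbour where `σ * H` is larger by 1 and `σ * d` is not smaller, against maximality. So both
  -- horizontal edges are crossed. For the other colour the same holds for the vertical edges.
  by_cases hc : checker x y = σ
  · have m1 : vDomino x y ∈ T₁ := by
      rcases vCount_eq T₁ x y with ⟨h, -⟩ | h0
      · exact h
      · exfalso
        rcases vCount_eq T₂ x y with ⟨-, h0'⟩ | h0' <;> rw [hc, h0] at r1 <;>
          rw [hc, h0, h0'] at r2 <;> rcases hσ with rfl | rfl <;> omega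
    have m2 : vDomino (x - 1) y ∈ T₁ := by
      rcases vCount_eq T₁ (x - 1) y with ⟨h, -⟩ | h0
      · exact h
      · exfalso
        rcases vCount_eq T₂ (x - 1) y with ⟨-, h0'⟩ | h0' <;> rw [hc, h0] at l1 <;>
          rw [hc, h0, h0'] at l2 <;> rcases hσ with rfl | rfl <;> omega
    exact ⟨_, h.flip_vertical m2 m1, hc ▸ hd.flip_vertical h m2 m1 hxy⟩
  · have hc' : checker x y = -σ := by
      rcases checker_eq x y with h | h <;> omega
    have m1 : hDomino x y ∈ T₁ := by
      rcases hCount_eq T₁ x y with ⟨h, -⟩ | h0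
      · exact h
      · exfalso
        rcases hCount_eq T₂ x y with ⟨-, h0'⟩ | h0' <;> rw [hc', h0] at u1 <;>
          rw [hc', h0, h0'] at u2 <;> rcases hσ with rfl | rfl <;> omega
    have m2 : hDomino x (y - 1) ∈ T₁ := by
      rcases hCount_eq T₁ x (y - 1) with ⟨h, -⟩ | h0
      · exact h
      · exfalso
        rcases hCount_eq T₂ x (y - 1) with ⟨-, h0'⟩ | h0' <;> rw [hc', h0] at b1 <;>
          rw [hc', h0, h0'] at b2 <;> rcases hσ with rfl | rfl <;> omega
    have hc2 : -checker x y = σ := by rw [hc', neg_neg]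
    exact ⟨_, h.flip_horizontal m2 m1, hc2 ▸ hd.flip_horizontal h m2 m1 hxy⟩

/-- Tilings of a simply connected region are connected by flips, by induction on the total height
difference. -/
theorem IsHeightDifference.flipConnected (hR : SimplyConnected R.toSet) (n : ℕ)
    {T₁ : Finset (Finset Square)} (h₁ : IsTiling R T₁) (h₂ : IsTiling R T₂) {d : ℤ → ℤ → ℤ}
    (hd : IsHeightDifference R T₁ T₂ d) (hn : ∑ v ∈ R, (d v.1 v.2).natAbs = n) :
    FlipConnected R T₁ T₂ := by
  induction n using Nat.strong_induction_on generalizing T₁ d with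
  | _ n ih =>
  by_cases h0 : ∀ x y, d x y = 0
  · have : T₁ = T₂ := by
      refine h₁.eq_of_count_eq h₂ (fun x y ↦ ?_) (fun x y ↦ ?_)
      · have := hd.horizontal x y
        rw [h0, h0] at this
        rcases checker_eq x y with h | h <;> rw [h] at this <;> omega
      · have := hd.vertical x y
        rw [h0, h0] at this
        rcases checker_eq x y with h | h <;> rw [h] at this <;> omega
    exact this ▸ Relation.ReflTransGen.refl
  · push Not at h0
    obtain ⟨p, q, hpq⟩ := h0
    obtain ⟨σ, hσ, hpos⟩ : ∃ σ : ℤ, (σ = 1 ∨ σ = -1) ∧ 0 < σ * d p q := by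
      rcases lt_or_gt_of_ne hpq with h | h
      · exact ⟨-1, .inr rfl, by omega⟩
      · exact ⟨1, .inl rfl, by omega⟩
    obtain ⟨x, y, hxy, T, hT, hdT⟩ := hd.exists_flip hR h₁ hσ ⟨p, q, hpos⟩
    refine Relation.ReflTransGen.head hT (ih _ ?_ hT.1 hdT rfl)
    rw [← hn]
    -- Since `σ * d x y` is positive, subtracting `σ` lowers the absolute value there by exactly 1;
    -- nothing else changes.
    refine Finset.sum_lt_sum (fun v _ ↦ ?_)
      ⟨(x, y), (hd.interior x y (right_ne_zero_of_mul hxy.ne')).1, ?_⟩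
    · split_ifs with hv
      · rw [← hv.1, ← hv.2] at hxy
        rcases hσ with rfl | rfl <;> omega
      · simp
    · rcases hσ with rfl | rfl <;> simp only [and_self, if_true] <;> omega

end DominoTiling

theorem mainTheorem2 (R : DominoTiling.Region)
    (hR : DominoTiling.SimplyConnected (DominoTiling.Region.toSet R))
    (T₁ T₂ : Finset (Finset DominoTiling.Square))
    (h₁ : DominoTiling.IsTiling R T₁) (h₂ : DominoTiling.IsTiling R T₂) :
    DominoTiling.FlipConnected R T₁ T₂ := by
  obtain ⟨d, hd⟩ := DominoTiling.exists_isHeightDifference hR h₁ h₂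
  exact hd.flipConnected hR _ h₁ h₂ rfl
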